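/- Let an isotropic elastic body with Lamé constants $\lambda,\mu$ ($\mu>0$, $\lambda+\mu>0$) and density $\rho>0$ occupy the half-plane $x_2<\delta$, $\delta>0$, with traction-free boundary $x_2=\delta$, and let a semi-infinite crack occupy $x_1<Vt$, $x_2=0$ at time $t>0$, where $0<V<c_R$ is constant and $c_R$ is the Rayleigh speed. Put $x=x_1-Vt$, $y=x_2$, $c_l^2=(\lambda+2\mu)/\rho$, $c_s^2=\mu/\rho$, and let $D=\{y<\delta\}\setminus\{x\le 0,\ y=0\}$. For $\operatorname{Re}s>0$ and a time-independent load $(\sigma_{12}^\circ,\sigma_{22}^\circ)$ of the crack line, applied to the crack faces from $t=0$ to the body at rest, the Laplace transforms in time $\hat\varphi,\hat\psi$ of the displacement potentials satisfy in $D$ $$c_l^2\Big(1-\tfrac{V^2}{c_l^2}\Big)\hat\varphi_{xx}+c_l^2\hat\varphi_{yy}+2Vs\hat\varphi_x-s^2\hat\varphi=0,\qquad c_s^2\Big(1-\tfrac{V^2}{c_s^2}\Big)\hat\psi_{xx}+c_s^2\hat\psi_{yy}+2Vs\hat\psi_x-s^2\hat\psi=0,$$ the displacements $\hat u=\hat\varphi_x+\hat\psi_y$,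 $\hat v=\hat\varphi_y-\hat\psi_x$ and their first derivatives are square integrable on $D$, and the stresses $\hat\sigma_{xy}=\mu(2\hat\varphi_{xy}-\hat\psi_{xx}+\hat\psi_{yy})$ and $\hat\sigma_{yy}=\lambda\hat\varphi_{xx}+(\lambda+2\mu)\hat\varphi_{yy}-2\mu\hat\psi_{xy}$ vanish on $y=\delta$ and satisfy, on both faces $y=0^\pm$, $x<0$, $$\hat\sigma_{xy}=-\int_0^\infty\sigma_{12}^\circ(x+Vt)e^{-st}dt,\qquad \hat\sigma_{yy}=-\int_0^\infty\sigma_{22}^\circ(x+Vt)e^{-st}dt.$$ The Laplace transforms of the stress intensity factors of modes $I$ and $II$ are $\hat K_I(s)=\lim_{x\to0^+}\sqrt{2\pi x}\,\hat\sigma_{yy}(x,0,s)$ and $\hat K_{II}(s)=\lim_{x\to0^+}\sqrt{2\pi x}\,\hat\sigma_{xy}(x,0,s)$. For $i,j\in\{I,II\}$ and $x_0\ge 0$, let $\hat W_{i,j}(x_0,s;V)$ be the factor $\hat K_i(s)$ that is determined by the unit point load of mode $j$ at $x_0$, that is $\sigma_{22}^\circ=\delta(x_1-x_0)$, $\sigma_{12}^\circ=0$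 for $j=I$, and $\sigma_{22}^\circ=0$, $\sigma_{12}^\circ=\delta(x_1-x_0)$ for $j=II$. The weight function $W_{i,j}(x_0,t;V)$ is the function of $t$, zero for $t<0$, whose Laplace transform is $\hat W_{i,j}(x_0,s;V)$ for $\operatorname{Re}s>0$. Then, for all $i,j\in\{I,II\}$ and all $x_0\ge0$: 1. For every $s$ with $\operatorname{Re}s>0$ and every $K\in\mathbb C$, the number $e^{-sx_0/V}K$ is a mode-$i$ factor $\hat K_i(s)$ for the point load of mode $j$ at $x_0$ if and only if $K$ is one for the point load of mode $j$ at $0$; the former is the only such value for $x_0$ if and only if the latter is the only one for $0$. Hence $$\hat W_{i,j}(x_0,s;V)=e^{-sx_0/V}\,\hat W_{i,j}(0,s;V).$$ 2. $$W_{i,j}(x_0,t;V)=W_{i,j}(0,t-x_0/V;V).$$ More precisely, if $W_0(t)$ is the weight function for the point $0$, then $W_0(t-x_0/V)$ is a weight function for $x_0$, and every weight function for $x_0$ equals it for almost every $t$. The relation also holds pointwise if the weight functions are given by the inversion formula: for every $\sigma>0$, $t\in\mathbb R$ and $w\in\mathbb C$, the symmetric improper integral $\frac1{2\pi i}\int_{\sigma-i\infty}^{\sigma+i\infty}\hat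 W_{i,j}(x_0,s;V)e^{st}ds$ converges to $w$ if and only if $\frac1{2\pi i}\int_{\sigma-i\infty}^{\sigma+i\infty}\hat W_{i,j}(0,s;V)e^{s(t-x_0/V)}ds$ does. -/

import Mathlib

open Set Filter Topology MeasureTheory

namespace MovingCrack

noncomputable section

/-- The elastic body, as Lamé constants, density and distance from the crack line to the free
boundary, together with the constant speed of the crack. -/
structure Body where
  lam : ℝ
  mu : ℝ
  rho : ℝ
  delta : ℝ
  V : ℝ

/-- Longitudinal wave speed. -/
def Body.cl (B : Body) : ℝ := Real.sqrt ((B.lam + 2 * B.mu) / B.rho)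

/-- Shear wave speed. -/
def Body.cs (B : Body) : ℝ := Real.sqrt (B.mu / B.rho)

/-- `c` is the Rayleigh speed of the medium: the zero, between `0` and the shear wave speed, of
`4 α β - (1 + β²)²`, where `α² = 1 - c²/cl²` and `β² = 1 - c²/cs²`. -/
def Body.IsRayleighSpeed (B : Body) (c : ℝ) : Prop :=
  0 < c ∧ c < B.cs ∧
    4 * Real.sqrt (1 - (c / B.cl) ^ 2) * Real.sqrt (1 - (c / B.cs) ^ 2)
      = (1 + (1 - (c / B.cs) ^ 2)) ^ 2

/-- Admissible data: a stable elastic medium (positive definite plane strain energy), a free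
boundary at positive distance, and a positive sub-Rayleigh crack speed. -/
structure Body.Admissible (B : Body) : Prop where
  mu_pos : 0 < B.mu
  lam_add_mu_pos : 0 < B.lam + B.mu
  rho_pos : 0 < B.rho
  delta_pos : 0 < B.delta
  V_pos : 0 < B.V
  subRayleigh : ∃ cR, B.IsRayleighSpeed cR ∧ B.V < cR

/-- The cracked body in the coordinates `x = x₁ - V t`, `y = x₂` of the crack tip: the half-plane
`y < δ` without the crack `x ≤ 0`, `y = 0`. -/
def Body.domain (B : Body) : Set (ℝ × ℝ) := {z | z.2 < B.delta ∧ ¬(z.1 ≤ 0 ∧ z.2 = 0)}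

/-- The partial derivative in the first variable. -/
def dx (f : ℝ × ℝ → ℂ) (z : ℝ × ℝ) : ℂ := deriv (fun x : ℝ => f (x, z.2)) z.1

/-- The partial derivative in the second variable. -/
def dy (f : ℝ × ℝ → ℂ) (z : ℝ × ℝ) : ℂ := deriv (fun y : ℝ => f (z.1, y)) z.2

/-- Displacement along the crack, `u = φ_x + ψ_y`. -/
def dispU (φ ψ : ℝ × ℝ → ℂ) (z : ℝ × ℝ) : ℂ := dx φ z + dy ψ z

/-- Displacement across the crack, `v = φ_y - ψ_x`. -/
def dispV (φ ψ : ℝ × ℝ → ℂ) (z : ℝ × ℝ) : ℂ := dy φ z - dx ψ z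

/-- The two modes: opening (`I`, stress `σ_yy`) and in-plane shear (`II`, stress `σ_xy`). -/
inductive Mode
  | I
  | II
  deriving DecidableEq

/-- The stress that belongs to a mode, in terms of the displacement potentials: `σ_yy` for mode I
and `σ_xy` for mode II. -/
def Body.stress (B : Body) (φ ψ : ℝ × ℝ → ℂ) : Mode → ℝ × ℝ → ℂ
  | Mode.I => fun z => B.lam * dx (dx φ) z + (B.lam + 2 * B.mu) * dy (dy φ) z
      - 2 * B.mu * dx (dy ψ) z
  | Mode.II => fun z => B.mu * (2 * dx (dy φ) z - dx (dx ψ) z + dy (dy ψ) z)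

/-- The wave equation with speed `c` in the moving coordinates after the Laplace transform in time
(zero initial data):
`c² (1 - V²/c²) f_xx + c² f_yy + 2 V s f_x - s² f = 0` in the cracked body. -/
def Body.WaveEq (B : Body) (c : ℝ) (s : ℂ) (f : ℝ × ℝ → ℂ) : Prop :=
  ∀ z ∈ B.domain,
    (c : ℂ) ^ 2 * (1 - ((B.V : ℂ) / c) ^ 2) * dx (dx f) z + (c : ℂ) ^ 2 * dy (dy f) z
      + 2 * B.V * s * dx f z - s ^ 2 * f z = 0

/-- Laplace transform in time of a time-independent load `m` on the line of the crack, seen from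
the crack tip: `∫₀^∞ σ(x + V t) exp (-s t) dt` if `m` has the density `σ`. It is written in the
variable `ξ = x + V t`, which makes sense for point forces too. -/
def transformedLoad (V : ℝ) (m : Measure ℝ) (s : ℂ) (x : ℝ) : ℂ :=
  ∫ ξ in Ioi x, (1 / (V : ℂ)) * Complex.exp (-s * ((ξ : ℂ) - x) / V) ∂m

/-- `φ`, `ψ` are the Laplace transforms, at the point `s`, of the displacement potentials of the
motion of the body caused by the loads `m Mode.I` (for `σ₂₂`) and `m Mode.II` (for `σ₁₂`) on the
crack faces: the transformed wave equations hold in the cracked body, the displacement has finite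
energy, the boundary is free of traction and the tractions on both faces of the crack are prescribed
by the loads. -/
structure Body.IsSolution (B : Body) (m : Mode → Measure ℝ) (s : ℂ) (φ ψ : ℝ × ℝ → ℂ) :
    Prop where
  smooth_phi : ContDiffOn ℝ 2 φ B.domain
  smooth_psi : ContDiffOn ℝ 2 ψ B.domain
  wave_phi : B.WaveEq B.cl s φ
  wave_psi : B.WaveEq B.cs s ψ
  memLp_u : MemLp (dispU φ ψ) 2 (volume.restrict B.domain)
  memLp_v : MemLp (dispV φ ψ) 2 (volume.restrict B.domain)
  memLp_ux : MemLp (dx (dispU φ ψ)) 2 (volume.restrict B.domain)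
  memLp_uy : MemLp (dy (dispU φ ψ)) 2 (volume.restrict B.domain)
  memLp_vx : MemLp (dx (dispV φ ψ)) 2 (volume.restrict B.domain)
  memLp_vy : MemLp (dy (dispV φ ψ)) 2 (volume.restrict B.domain)
  free_boundary : ∀ (k : Mode) (x : ℝ),
    Tendsto (B.stress φ ψ k) (𝓝[B.domain] (x, B.delta)) (𝓝 0)
  upper_face : ∀ (k : Mode) (x : ℝ), x < 0 →
    Tendsto (B.stress φ ψ k) (𝓝[B.domain ∩ {z | 0 < z.2}] (x, 0))
      (𝓝 (-transformedLoad B.V (m k) s x))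
  lower_face : ∀ (k : Mode) (x : ℝ), x < 0 →
    Tendsto (B.stress φ ψ k) (𝓝[B.domain ∩ {z | z.2 < 0}] (x, 0))
      (𝓝 (-transformedLoad B.V (m k) s x))

/-- `K` is the stress intensity factor of mode `i`:
`σ(x, 0) ~ K / √(2 π x)` ahead of the crack tip. -/
def Body.HasSIF (B : Body) (φ ψ : ℝ × ℝ → ℂ) (i : Mode) (K : ℂ) : Prop :=
  Tendsto (fun x : ℝ => (Real.sqrt (2 * Real.pi * x) : ℂ) * B.stress φ ψ i (x, 0))
    (𝓝[>] 0) (𝓝 K)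

/-- The unit point load of mode `j` at the point `x₀` of the line of the crack. -/
def pointLoad (j : Mode) (x₀ : ℝ) (k : Mode) : Measure ℝ :=
  if k = j then Measure.dirac x₀ else 0

/-- `K` is the mode-`i` stress intensity factor of some solution, in the Laplace domain, of the
problem with the unit point load of mode `j` at `x₀`. -/
def Body.IsPointLoadSIF (B : Body) (i j : Mode) (x₀ : ℝ) (s K : ℂ) : Prop :=
  ∃ φ ψ : ℝ × ℝ → ℂ, B.IsSolution (pointLoad j x₀) s φ ψ ∧ B.HasSIF φ ψ i K

/-- `K` is the value `Ŵ_{i,j}(x₀, s; V)` of the Laplace transform of the weight function: the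
mode-`i` stress intensity factor that is determined by the unit point load of mode `j` at `x₀`. -/
def Body.IsWeightTransform (B : Body) (i j : Mode) (x₀ : ℝ) (s K : ℂ) : Prop :=
  B.IsPointLoadSIF i j x₀ s K ∧ ∀ K', B.IsPointLoadSIF i j x₀ s K' → K' = K

/-- `W` is the weight function `t ↦ W_{i,j}(x₀, t; V)`: it vanishes for negative times and its
Laplace transform is `Ŵ_{i,j}(x₀, s; V)` for all `s` with positive real part. -/
structure Body.IsWeightFunction (B : Body) (i j : Mode) (x₀ : ℝ) (W : ℝ → ℝ) : Prop where
  causal : ∀ t < 0, W t = 0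
  integrable : ∀ s : ℂ, 0 < s.re →
    IntegrableOn (fun t : ℝ => (W t : ℂ) * Complex.exp (-s * t)) (Ioi 0)
  transform : ∀ s : ℂ, 0 < s.re →
    B.IsWeightTransform i j x₀ s (∫ t in Ioi (0 : ℝ), (W t : ℂ) * Complex.exp (-s * t))

/-- The inversion integral `(2πi)⁻¹ ∫ F(s) exp (s t) ds` over the line `Re s = σ`, taken as a
symmetric improper integral, converges to `w`. -/
def InverseLaplaceAt (F : ℂ → ℂ) (σ t : ℝ) (w : ℂ) : Prop :=
  Tendsto (fun R : ℝ => (1 / (2 * Real.pi) : ℂ) *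
      ∫ τ in (-R)..R, F (σ + τ * Complex.I) * Complex.exp ((σ + τ * Complex.I) * t))
    atTop (𝓝 w)

end

end MovingCrack

namespace MovingCrack

/-! In the frame of the tip, a unit point force at `x₀` produces at a face point `x < 0` the
transformed traction `-(1/V) exp (-s (x₀ - x) / V)`. For `x₀ ≥ 0` the force lies ahead of every such
`x`, so `x₀` enters only through the factor `exp (-s x₀ / V)`, which does not depend on `x`. The
boundary value problem is linear, and multiplication by this nonzero constant maps the solutions for
the load at `0` bijectively onto those for the load at `x₀`, scaling the stress intensity factors
alike. Neither existence nor uniqueness of solutions is needed: the sets of possible factors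
correspond.

In time the factor is a delay by `x₀ / V ≥ 0`, which preserves causality. Uniqueness almost
everywhere comes from injectivity of the Fourier transform on a vertical line; in the inversion
integral the factor is absorbed into `exp (s t)`. -/

/-- An integrable real function with vanishing Fourier transform vanishes almost everywhere. -/
theorem ae_eq_zero_of_integral_exp_eq_zero {f : ℝ → ℝ} (hf : Integrable f)
    (h : ∀ τ : ℝ, ∫ t, (f t : ℂ) * Complex.exp (τ * t * Complex.I) = 0) :
    f =ᵐ[volume] 0 := by
  have hae : AEMeasurable f := hf.aemeasurable
  have hneg : AEMeasurable (fun t => -f t) := hae.neg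
  have : IsFiniteMeasure (volume.withDensity fun t => ENNReal.ofReal (f t)) :=
    isFiniteMeasure_withDensity_ofReal hf.2
  have : IsFiniteMeasure (volume.withDensity fun t => ENNReal.ofReal (-f t)) :=
    isFiniteMeasure_withDensity_ofReal hf.neg.2
  have integrable_mul_exp : ∀ (g : ℝ → ℝ) (τ : ℝ), Integrable g →
      Integrable fun t => (g t : ℂ) * Complex.exp (τ * t * Complex.I) := by
    intro g τ hg
    refine hg.ofReal.mul_bdd (c := 1) (by fun_prop) (Eventually.of_forall fun t => ?_)
    rw [← Complex.ofReal_mul, Complex.norm_exp_ofReal_mul_I]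
  have charFun_eq : ∀ g : ℝ → ℝ, AEMeasurable g → ∀ τ : ℝ,
      charFun (volume.withDensity fun t => ENNReal.ofReal (g t)) τ =
        ∫ t, ((max (g t) 0 : ℝ) : ℂ) * Complex.exp (τ * t * Complex.I) := by
    intro g hg τ
    rw [charFun_apply_real, integral_withDensity_eq_integral_toReal_smul₀ hg.ennreal_ofReal
      (Eventually.of_forall fun _ => ENNReal.ofReal_lt_top)]
    simp only [ENNReal.toReal_ofReal', Complex.real_smul]
  -- The positive and negative parts of `f` are densities of finite measures; their characteristic
  -- functions differ by the Fourier transform of `f`, hence agree.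
  have key : (volume.withDensity fun t => ENNReal.ofReal (f t)) =
      volume.withDensity fun t => ENNReal.ofReal (-f t) := by
    refine Measure.ext_of_charFun (funext fun τ => ?_)
    rw [charFun_eq _ hae, charFun_eq _ hneg, ← sub_eq_zero,
      ← integral_sub (integrable_mul_exp _ _ hf.pos_part)
        (integrable_mul_exp _ _ hf.neg_part), ← h τ]
    refine integral_congr_ae (Eventually.of_forall fun t => ?_)
    simp only [← sub_mul, ← Complex.ofReal_sub]
    rw [max_zero_sub_max_neg_zero_eq_self]
  have hofReal := (withDensity_eq_iff hae.ennreal_ofReal hneg.ennreal_ofReal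
    (by
      rw [← setLIntegral_univ, ← withDensity_apply _ MeasurableSet.univ]
      exact measure_ne_top _ _)).1 key
  filter_upwards [hofReal] with t ht
  rcases le_total 0 (f t) with h0 | h0
  · rw [ENNReal.ofReal_of_nonpos (neg_nonpos.2 h0), ENNReal.ofReal_eq_zero] at ht
    exact le_antisymm ht h0
  · rw [ENNReal.ofReal_of_nonpos h0, eq_comm, ENNReal.ofReal_eq_zero, neg_nonpos] at ht
    exact le_antisymm h0 ht

/-- Only the value at `0` is unconstrained, and a point is null. -/
theorem indicator_Ioi_ae_eq_of_causal {g : ℝ → ℂ} (hg : ∀ t < 0, g t = 0) :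
    (Ioi (0 : ℝ)).indicator g =ᵐ[volume] g := by
  filter_upwards [Measure.ae_ne volume (0 : ℝ)] with t ht
  rcases lt_or_gt_of_ne ht with h | h
  · rw [indicator_of_notMem (by simpa using h.le), hg t h]
  · rw [indicator_of_mem (by simpa using h)]

theorem setIntegral_Ioi_eq_integral_of_causal {g : ℝ → ℂ} (hg : ∀ t < 0, g t = 0) :
    ∫ t in Ioi (0 : ℝ), g t = ∫ t, g t := by
  rw [← integral_indicator measurableSet_Ioi]
  exact integral_congr_ae (indicator_Ioi_ae_eq_of_causal hg)

theorem integrableOn_Ioi_iff_of_causal {g : ℝ → ℂ} (hg : ∀ t < 0, g t = 0) :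
    IntegrableOn g (Ioi 0) ↔ Integrable g := by
  rw [← integrable_indicator_iff measurableSet_Ioi]
  exact integrable_congr (indicator_Ioi_ae_eq_of_causal hg)

/-- A causal function is determined almost everywhere by its Laplace transform on the line
`Re s = 1`. -/
theorem ae_eq_of_laplace_eq {W W' : ℝ → ℝ} (hW : ∀ t < 0, W t = 0) (hW' : ∀ t < 0, W' t = 0)
    (hi : ∀ s : ℂ, 0 < s.re →
      IntegrableOn (fun t : ℝ => (W t : ℂ) * Complex.exp (-s * t)) (Ioi 0))
    (hi' : ∀ s : ℂ, 0 < s.re →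
      IntegrableOn (fun t : ℝ => (W' t : ℂ) * Complex.exp (-s * t)) (Ioi 0))
    (h : ∀ s : ℂ, 0 < s.re →
      ∫ t in Ioi (0 : ℝ), (W t : ℂ) * Complex.exp (-s * t) =
        ∫ t in Ioi (0 : ℝ), (W' t : ℂ) * Complex.exp (-s * t)) :
    W =ᵐ[volume] W' := by
  have hz : ∀ s : ℂ, ∀ t < 0, (W t : ℂ) * Complex.exp (-s * t) = 0 := fun s t ht => by
    simp [hW t ht]
  have hz' : ∀ s : ℂ, ∀ t < 0, (W' t : ℂ) * Complex.exp (-s * t) = 0 := fun s t ht => by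
    simp [hW' t ht]
  have hI := fun s hs => (integrableOn_Ioi_iff_of_causal (hz s)).1 (hi s hs)
  have hI' := fun s hs => (integrableOn_Ioi_iff_of_causal (hz' s)).1 (hi' s hs)
  -- The weight `exp (-t)` turns the Laplace transform at `s = 1 - iτ` into a Fourier transform at
  -- `τ`.
  have hf : Integrable fun t => (W t - W' t) * Real.exp (-t) := by
    refine (((hI 1 (by simp)).sub (hI' 1 (by simp))).re).congr (Eventually.of_forall fun t => ?_)
    simp only [Pi.sub_apply, ← sub_mul, neg_mul, one_mul, ← Complex.ofReal_neg,
      ← Complex.ofReal_exp, ← Complex.ofReal_sub, ← Complex.ofReal_mul]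
    exact Complex.ofReal_re _
  have hzero := ae_eq_zero_of_integral_exp_eq_zero hf fun τ => by
    have hs : 0 < (1 - τ * Complex.I : ℂ).re := by simp
    have := h _ hs
    rw [setIntegral_Ioi_eq_integral_of_causal (hz _), setIntegral_Ioi_eq_integral_of_causal (hz' _),
      ← sub_eq_zero, ← integral_sub (hI _ hs) (hI' _ hs)] at this
    rw [← this]
    refine integral_congr_ae (Eventually.of_forall fun t => ?_)
    simp only [← sub_mul]
    push_cast
    rw [mul_assoc, ← Complex.exp_add]
    congr 2
    ring
  filter_upwards [hzero] with t ht
  have := (mul_eq_zero.1 ht).resolve_right (Real.exp_pos _).ne'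
  linarith

/-- No differentiability is needed: over a field the scalar is zero or invertible. Hence this is an
identity of functions on the whole plane and can be iterated. -/
theorem dx_const_mul (c : ℂ) (f : ℝ × ℝ → ℂ) :
    dx (fun z => c * f z) = fun z => c * dx f z :=
  funext fun _ => deriv_const_mul_field c

theorem dy_const_mul (c : ℂ) (f : ℝ × ℝ → ℂ) :
    dy (fun z => c * f z) = fun z => c * dy f z :=
  funext fun _ => deriv_const_mul_field c

theorem dispU_const_mul (c : ℂ) (φ ψ : ℝ × ℝ → ℂ) :
    dispU (fun z => c * φ z) (fun z => c * ψ z) = fun z => c * dispU φ ψ z := by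
  funext z
  simp only [dispU, dx_const_mul, dy_const_mul]
  ring

theorem dispV_const_mul (c : ℂ) (φ ψ : ℝ × ℝ → ℂ) :
    dispV (fun z => c * φ z) (fun z => c * ψ z) = fun z => c * dispV φ ψ z := by
  funext z
  simp only [dispV, dx_const_mul, dy_const_mul]
  ring

theorem Body.stress_const_mul (B : Body) (c : ℂ) (φ ψ : ℝ × ℝ → ℂ) (k : Mode) :
    B.stress (fun z => c * φ z) (fun z => c * ψ z) k = fun z => c * B.stress φ ψ k z := by
  cases k <;>
  · funext z
    simp only [Body.stress, dx_const_mul, dy_const_mul]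
    ring

theorem Body.WaveEq.const_mul {B : Body} {v : ℝ} {s : ℂ} {f : ℝ × ℝ → ℂ} (h : B.WaveEq v s f)
    (c : ℂ) : B.WaveEq v s fun z => c * f z := by
  intro z hz
  simp only [dx_const_mul, dy_const_mul]
  linear_combination c * h z hz

theorem Body.HasSIF.const_mul {B : Body} {φ ψ : ℝ × ℝ → ℂ} {i : Mode} {K : ℂ}
    (h : B.HasSIF φ ψ i K) (c : ℂ) :
    B.HasSIF (fun z => c * φ z) (fun z => c * ψ z) i (c * K) := by
  have := Tendsto.const_mul c h
  simpa only [Body.HasSIF, Body.stress_const_mul, mul_left_comm] using this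

/-- The problem is linear, and depends on the loads only through the tractions on the crack. -/
theorem Body.IsSolution.const_mul {B : Body} {m m' : Mode → Measure ℝ} {s c : ℂ}
    {φ ψ : ℝ × ℝ → ℂ} (h : B.IsSolution m s φ ψ)
    (hm : ∀ k, ∀ x < 0, transformedLoad B.V (m' k) s x = c * transformedLoad B.V (m k) s x) :
    B.IsSolution m' s (fun z => c * φ z) (fun z => c * ψ z) where
  smooth_phi := contDiffOn_const.mul h.smooth_phi
  smooth_psi := contDiffOn_const.mul h.smooth_psi
  wave_phi := h.wave_phi.const_mul c
  wave_psi := h.wave_psi.const_mul c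
  memLp_u := by simpa only [dispU_const_mul] using h.memLp_u.const_mul c
  memLp_v := by simpa only [dispV_const_mul] using h.memLp_v.const_mul c
  memLp_ux := by simpa only [dispU_const_mul, dx_const_mul] using h.memLp_ux.const_mul c
  memLp_uy := by simpa only [dispU_const_mul, dy_const_mul] using h.memLp_uy.const_mul c
  memLp_vx := by simpa only [dispV_const_mul, dx_const_mul] using h.memLp_vx.const_mul c
  memLp_vy := by simpa only [dispV_const_mul, dy_const_mul] using h.memLp_vy.const_mul c
  free_boundary k x := by
    simpa only [Body.stress_const_mul, mul_zero] using (h.free_boundary k x).const_mul c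
  upper_face k x hx := by
    simpa only [Body.stress_const_mul, hm k x hx, mul_neg] using (h.upper_face k x hx).const_mul c
  lower_face k x hx := by
    simpa only [Body.stress_const_mul, hm k x hx, mul_neg] using (h.lower_face k x hx).const_mul c

theorem transformedLoad_dirac (V : ℝ) (s : ℂ) {x x₀ : ℝ} (h : x < x₀) :
    transformedLoad V (Measure.dirac x₀) s x =
      1 / (V : ℂ) * Complex.exp (-s * ((x₀ : ℂ) - x) / V) := by
  rw [transformedLoad, setIntegral_dirac, if_pos (mem_Ioi.2 h)]

/-- Ahead of both points, a point load at `x₁` produces the tractions of one at `x₀`, up to the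
factor of the time delay. -/
theorem transformedLoad_pointLoad (V : ℝ) (j k : Mode) (s : ℂ) {x x₀ x₁ : ℝ} (h₀ : x < x₀)
    (h₁ : x < x₁) :
    transformedLoad V (pointLoad j x₁ k) s x =
      Complex.exp (-s * ((x₁ : ℂ) - x₀) / V) * transformedLoad V (pointLoad j x₀ k) s x := by
  by_cases hk : k = j
  · simp only [pointLoad, if_pos hk]
    rw [transformedLoad_dirac V s h₀, transformedLoad_dirac V s h₁, mul_left_comm,
      ← Complex.exp_add]
    congr 2
    ring
  · simp [pointLoad, if_neg hk, transformedLoad]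

/-- Both points are arbitrary so that swapping them gives the inverse map. -/
theorem Body.IsPointLoadSIF.shift {B : Body} {i j : Mode} {x₀ x₁ : ℝ} {s K : ℂ}
    (h : B.IsPointLoadSIF i j x₀ s K) (h₀ : 0 ≤ x₀) (h₁ : 0 ≤ x₁) :
    B.IsPointLoadSIF i j x₁ s (Complex.exp (-s * ((x₁ : ℂ) - x₀) / B.V) * K) := by
  obtain ⟨φ, ψ, hsol, hK⟩ := h
  exact ⟨_, _, hsol.const_mul fun k x hx =>
    transformedLoad_pointLoad B.V j k s (hx.trans_le h₀) (hx.trans_le h₁), hK.const_mul _⟩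

theorem Body.isPointLoadSIF_exp_mul_iff (B : Body) (i j : Mode) {x₀ : ℝ} (hx₀ : 0 ≤ x₀)
    (s K : ℂ) :
    B.IsPointLoadSIF i j x₀ s (Complex.exp (-s * x₀ / B.V) * K) ↔
      B.IsPointLoadSIF i j 0 s K := by
  constructor <;> intro h
  · have := h.shift hx₀ le_rfl
    rwa [← mul_assoc, ← Complex.exp_add, Complex.ofReal_zero, ← add_div,
      show -s * (0 - (x₀ : ℂ)) + -s * x₀ = 0 by ring, zero_div, Complex.exp_zero, one_mul] at this
  · simpa using h.shift le_rfl hx₀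

theorem Body.isWeightTransform_exp_mul_iff (B : Body) (i j : Mode) {x₀ : ℝ} (hx₀ : 0 ≤ x₀)
    (s K : ℂ) :
    B.IsWeightTransform i j x₀ s (Complex.exp (-s * x₀ / B.V) * K) ↔
      B.IsWeightTransform i j 0 s K := by
  have hc : Complex.exp (-s * x₀ / B.V) ≠ 0 := Complex.exp_ne_zero _
  refine and_congr (B.isPointLoadSIF_exp_mul_iff i j hx₀ s K) ⟨fun h K' hK' => ?_,
    fun h K' hK' => ?_⟩
  · exact mul_left_cancel₀ hc (h _ ((B.isPointLoadSIF_exp_mul_iff i j hx₀ s K').2 hK'))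
  -- As the factor is nonzero, every competitor for `x₀` comes from one for `0`.
  · obtain ⟨L, rfl⟩ : ∃ L, K' = Complex.exp (-s * x₀ / B.V) * L :=
      ⟨_, (mul_div_cancel₀ K' hc).symm⟩
    rw [h L ((B.isPointLoadSIF_exp_mul_iff i j hx₀ s L).1 hK')]

theorem Body.IsWeightTransform.eq_exp_mul {B : Body} {i j : Mode} {x₀ : ℝ} {s K K₀ : ℂ}
    (hK : B.IsWeightTransform i j x₀ s K) (hK₀ : B.IsWeightTransform i j 0 s K₀)
    (hx₀ : 0 ≤ x₀) : K = Complex.exp (-s * x₀ / B.V) * K₀ :=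
  ((B.isWeightTransform_exp_mul_iff i j hx₀ s K₀).2 hK₀).2 K hK.1

theorem Body.IsWeightFunction.shift {B : Body} {i j : Mode} {x₀ : ℝ} {W₀ : ℝ → ℝ}
    (h : B.IsWeightFunction i j 0 W₀) (hV : 0 < B.V) (hx₀ : 0 ≤ x₀) :
    B.IsWeightFunction i j x₀ fun t => W₀ (t - x₀ / B.V) := by
  have ha : 0 ≤ x₀ / B.V := div_nonneg hx₀ hV.le
  have hcausal : ∀ t < 0, W₀ (t - x₀ / B.V) = 0 := fun t ht => h.causal _ (by linarith)
  have hz : ∀ s : ℂ, ∀ t < 0, (W₀ t : ℂ) * Complex.exp (-s * t) = 0 := fun s t ht => by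
    simp [h.causal t ht]
  have hz' : ∀ s : ℂ, ∀ t < 0, (W₀ (t - x₀ / B.V) : ℂ) * Complex.exp (-s * t) = 0 :=
    fun s t ht => by simp [hcausal t ht]
  -- Apart from the delay factor, the integrand is a translate of the one for `0`. Causality lets
  -- both integrals run over `ℝ`, where translation is harmless.
  have hshift : ∀ s : ℂ, (fun t : ℝ => (W₀ (t - x₀ / B.V) : ℂ) * Complex.exp (-s * t)) =
      fun t : ℝ => Complex.exp (-s * x₀ / B.V) *
        ((W₀ (t - x₀ / B.V) : ℂ) * Complex.exp (-s * (t - x₀ / B.V : ℝ))) := fun s => by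
    funext t
    rw [mul_left_comm, ← Complex.exp_add]
    congr 2
    push_cast
    ring
  refine ⟨hcausal, fun s hs => ?_, fun s hs => ?_⟩
  · rw [integrableOn_Ioi_iff_of_causal (hz' s), hshift s]
    exact (((integrableOn_Ioi_iff_of_causal (hz s)).1 (h.integrable s hs)).comp_sub_right
      (x₀ / B.V)).const_mul _
  · rw [setIntegral_Ioi_eq_integral_of_causal (hz' s), hshift s, integral_const_mul,
      integral_sub_right_eq_self (fun t : ℝ => (W₀ t : ℂ) * Complex.exp (-s * t)),
      ← setIntegral_Ioi_eq_integral_of_causal (hz s)]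
    exact (B.isWeightTransform_exp_mul_iff i j hx₀ s _).2 (h.transform s hs)

/-- The uniqueness clause of `IsWeightTransform` forces the two Laplace transforms to coincide. -/
theorem Body.IsWeightFunction.ae_eq {B : Body} {i j : Mode} {x₀ : ℝ} {W W' : ℝ → ℝ}
    (h : B.IsWeightFunction i j x₀ W) (h' : B.IsWeightFunction i j x₀ W') :
    W =ᵐ[volume] W' :=
  ae_eq_of_laplace_eq h.causal h'.causal h.integrable h'.integrable fun s hs =>
    (h'.transform s hs).2 _ (h.transform s hs).1

/-- The shift rule for the inversion integral. -/
theorem inverseLaplaceAt_iff_of_eq_exp_mul {F F₀ : ℂ → ℂ} {a σ : ℝ}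
    (h : ∀ τ : ℝ, F (σ + τ * Complex.I) =
      Complex.exp (-(σ + τ * Complex.I) * a) * F₀ (σ + τ * Complex.I)) (t : ℝ) (w : ℂ) :
    InverseLaplaceAt F σ t w ↔ InverseLaplaceAt F₀ σ (t - a) w := by
  have key : ∀ τ : ℝ, F (σ + τ * Complex.I) * Complex.exp ((σ + τ * Complex.I) * t) =
      F₀ (σ + τ * Complex.I) * Complex.exp ((σ + τ * Complex.I) * (t - a : ℝ)) := fun τ => by
    rw [h τ, mul_comm (Complex.exp _), mul_assoc, ← Complex.exp_add]
    congr 2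
    push_cast
    ring
  simp only [InverseLaplaceAt, key]

end MovingCrack

theorem mainTheorem3 (B : MovingCrack.Body) (hB : B.Admissible) (i j : MovingCrack.Mode)
    (x₀ : ℝ) (hx₀ : 0 ≤ x₀) :
    -- the relation between the Laplace transforms
    (∀ s : ℂ, 0 < s.re → ∀ K : ℂ,
      (B.IsPointLoadSIF i j x₀ s (Complex.exp (-s * x₀ / B.V) * K) ↔
        B.IsPointLoadSIF i j 0 s K) ∧
      (B.IsWeightTransform i j x₀ s (Complex.exp (-s * x₀ / B.V) * K) ↔
        B.IsWeightTransform i j 0 s K)) ∧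
    (∀ s : ℂ, 0 < s.re → ∀ K K₀ : ℂ,
      B.IsWeightTransform i j x₀ s K → B.IsWeightTransform i j 0 s K₀ →
        K = Complex.exp (-s * x₀ / B.V) * K₀) ∧
    -- the relation between the weight functions
    (∀ W₀ : ℝ → ℝ, B.IsWeightFunction i j 0 W₀ →
      B.IsWeightFunction i j x₀ (fun t => W₀ (t - x₀ / B.V)) ∧
      ∀ W : ℝ → ℝ, B.IsWeightFunction i j x₀ W →
        ∀ᵐ t : ℝ, W t = W₀ (t - x₀ / B.V)) ∧
    -- the relation between the weight functions given pointwise by the inversion integral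
    (∀ F F₀ : ℂ → ℂ,
      (∀ s : ℂ, 0 < s.re → B.IsWeightTransform i j x₀ s (F s)) →
      (∀ s : ℂ, 0 < s.re → B.IsWeightTransform i j 0 s (F₀ s)) →
      ∀ σ : ℝ, 0 < σ → ∀ (t : ℝ) (w : ℂ),
        MovingCrack.InverseLaplaceAt F σ t w ↔
          MovingCrack.InverseLaplaceAt F₀ σ (t - x₀ / B.V) w) := by
  refine ⟨fun s _ K => ⟨B.isPointLoadSIF_exp_mul_iff i j hx₀ s K,
      B.isWeightTransform_exp_mul_iff i j hx₀ s K⟩,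
    fun s _ K K₀ hK hK₀ => hK.eq_exp_mul hK₀ hx₀,
    fun W₀ hW₀ => ⟨hW₀.shift hB.V_pos hx₀, fun W hW => hW.ae_eq (hW₀.shift hB.V_pos hx₀)⟩,
    fun F F₀ hF hF₀ σ hσ t w => ?_⟩
  refine MovingCrack.inverseLaplaceAt_iff_of_eq_exp_mul (fun τ => ?_) t w
  have hs : 0 < (σ + τ * Complex.I : ℂ).re := by simpa using hσ
  rw [(hF _ hs).eq_exp_mul (hF₀ _ hs) hx₀, Complex.ofReal_div, mul_div_assoc]
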